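/- Let $s,k,r,n,m\ge 0$ be integers with $k\le s$. For a field $K$, a form is a $K$-linear map $\Psi:\bigwedge^s K^n\to K^m$. The $k$-nullity $\mathrm{null}_k(\Psi)$ is the maximum of the dimensions of linear subspaces $W\subset K^n$ such that $\Psi(w_1\wedge\dots\wedge w_k\wedge v_{k+1}\wedge\dots\wedge v_s)=0$ for all $w_1,\dots,w_k\in W$ and $v_{k+1},\dots,v_s\in K^n$. (Such a $W$ exists whenever $k\ge 1$; if $k=0$ and $\Psi\neq 0$ there is none, and we put $\mathrm{null}_0(\Psi)=0$.) The space $(\bigwedge^s K^n)^*\otimes K^m$ of all forms is given the coordinates $\Psi(e_{i_1}\wedge\dots\wedge e_{i_s})_j$, $1\le i_1<\dots<i_s\le n$, $1\le j\le m$, with $e_1,\dots,e_n$ the standard basis of $K^n$. 1. If $K$ is an algebraically closed field, then the set of forms $\Psi:\bigwedge^s K^n\to K^m$ with $\mathrm{null}_k(\Psi)\ge r$ is a closed algebraic subset of $(\bigwedge^s K^n)^*\otimes K^m$ defined by homogeneous polynomials; that is, it is the set of common zeros of finitely many homogeneous polynomials over $K$ in the coordinates of $\Psi$. 2. Let $K$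 be an arbitrary field with algebraic closure $\overline K$, and for a form $\Psi$ over $K$ let $\overline\Psi:\bigwedge^s\overline K^n\to\overline K^m$ be its extension of scalars. Then the set of forms $\Psi:\bigwedge^s K^n\to K^m$ with $\mathrm{null}_k(\overline\Psi)\ge r$ is a closed algebraic subset of $(\bigwedge^s K^n)^*\otimes K^m$ defined by finitely many homogeneous polynomials with coefficients in $K$. (Nonzero constants count as homogeneous polynomials of degree $0$; they are needed when the set is empty, that is, when $r>n$.) -/

import Mathlib

/-- A skew-symmetric (alternating) `s`-form on `K ^ n` with values in `K ^ m`, that is, a linear map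
`⋀ ^ s K ^ n → K ^ m`. -/
abbrev SkewForm (K : Type*) [Field K] (s n m : ℕ) : Type _ :=
  (⋀[K]^s (Fin n → K)) →ₗ[K] (Fin m → K)

namespace SkewForm

/-- The standard basis `e_{i_1} ∧ … ∧ e_{i_s}`, `i_1 < … < i_s`, of `⋀ ^ s K ^ n`; it is indexed by
the `s`-element subsets of `Fin n`. -/
noncomputable def wedgeBasis (K : Type*) [Field K] (s n : ℕ) :
    Module.Basis (Set.powersetCard (Fin n) s) K (⋀[K]^s (Fin n → K)) :=
  (Pi.basisFun K (Fin n)).exteriorPower s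

/-- `Ψ` vanishes whenever its first `k` arguments are taken from `W`, the remaining `s - k`
arguments being arbitrary: `Ψ(W, …, W, K ^ n, …, K ^ n) = 0`. -/
def VanishesOn {K : Type*} [Field K] {s n m : ℕ} (k : ℕ) (Ψ : SkewForm K s n m)
    (W : Submodule K (Fin n → K)) : Prop :=
  ∀ v : Fin s → Fin n → K, (∀ i : Fin s, (i : ℕ) < k → v i ∈ W) →
    Ψ (exteriorPower.ιMulti K s v) = 0

/-- The `k`-nullity of `Ψ`: the largest dimension of a subspace `W` of `K ^ n` such that
`Ψ(W, …, W, K ^ n, …, K ^ n) = 0` with `k` arguments `W`. The dimensions are bounded by `n`, and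
for `1 ≤ k ≤ s` the subspace `0` is admissible, so this is a genuine maximum; for `k = 0` and
`Ψ ≠ 0` no subspace is admissible and the value is `0`. -/
noncomputable def nullity {K : Type*} [Field K] {s n m : ℕ} (k : ℕ) (Ψ : SkewForm K s n m) : ℕ :=
  sSup {d : ℕ | ∃ W : Submodule K (Fin n → K), VanishesOn k Ψ W ∧ Module.finrank K W = d}

/-- The coordinates of a form in the space `(⋀ ^ s K ^ n)^* ⊗ K ^ m` of all forms, with respect to
the standard bases: the `(I, j)`-coordinate of `Ψ` is the `j`-th entry of `Ψ(e_I)`. -/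
noncomputable def coords {K : Type*} [Field K] {s n m : ℕ} (Ψ : SkewForm K s n m) :
    Set.powersetCard (Fin n) s × Fin m → K :=
  fun p => Ψ (wedgeBasis K s n p.1) p.2

/-- A set of forms is a closed algebraic subset defined by homogeneous polynomials with
coefficients in `K` if it is the set of common zeros, in the space of all forms over `K`, of finitely
many homogeneous polynomials over `K` in the coordinates of a form. -/
def IsHomogeneousAlgebraicSet {K : Type*} [Field K] {s n m : ℕ} (Z : Set (SkewForm K s n m)) :
    Prop :=
  ∃ S : Finset (MvPolynomial (Set.powersetCard (Fin n) s × Fin m) K),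
    (∀ F ∈ S, ∃ d : ℕ, F.IsHomogeneous d) ∧
      ∀ Ψ : SkewForm K s n m, Ψ ∈ Z ↔ ∀ F ∈ S, MvPolynomial.eval (coords Ψ) F = 0

/-- The extension of `Ψ : ⋀ ^ s K ^ n → K ^ m` to an extension field `L` of `K`: the `L`-linear map
`⋀ ^ s L ^ n → L ^ m` with the same values as `Ψ` on the standard basis vectors. -/
noncomputable def extendScalars {K : Type*} [Field K] {s n m : ℕ} (L : Type*) [Field L]
    [Algebra K L] (Ψ : SkewForm K s n m) : SkewForm L s n m :=
  (wedgeBasis L s n).constr L fun I j => algebraMap K L (Ψ (wedgeBasis K s n I) j)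

/-- The extended form agrees with `Ψ` on wedges of vectors with entries in `K`. -/
theorem extendScalars_iMulti {K : Type*} [Field K] {s n m : ℕ} (L : Type*) [Field L] [Algebra K L]
  (Ψ : SkewForm K s n m) (v : Fin s → Fin n → K) (j : Fin m) :
  extendScalars L Ψ (exteriorPower.ιMulti L s fun i a => algebraMap K L (v i a)) j
   = algebraMap K L (Ψ (exteriorPower.ιMulti K s v) j) := by
  have key : (exteriorPower.ιMulti L s fun i a => algebraMap K L (v i a)) =
     ∑ I, algebraMap K L ((wedgeBasis K s n).repr (exteriorPower.ιMulti K s v) I) • wedgeBasis L s n I := by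
    rw [← (wedgeBasis L s n).sum_repr (exteriorPower.ιMulti L s _)]
    refine Finset.sum_congr rfl fun I _ => ?_
    congr 1
    simp only [wedgeBasis, exteriorPower.basis_repr_apply, exteriorPower.ιMultiDual_apply_ιMulti]
    rw [RingHom.map_det]
    congr 1
  rw [key]
  conv_rhs => rw [← (wedgeBasis K s n).sum_repr (exteriorPower.ιMulti K s v)]
  simp only [extendScalars, map_sum, map_smul, Module.Basis.constr_basis, Finset.sum_apply,
    Pi.smul_apply, smul_eq_mul, map_mul]

end SkewForm

/-!
`Ψ` vanishes on a subspace of dimension at least `r` if and only if it vanishes on the span of the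
contractions with `r - 1` vectors of some nonzero alternating `r`-form `φ`. Indeed, these
contractions always span at least `r` dimensions, and if `φ = w₁ ∧ ⋯ ∧ wᵣ` they all lie in the span
of the `wᵢ`. No Plücker relations are needed, since `φ` need not be decomposable. So the condition
is that a system of equations, homogeneous in `φ` and linear in `Ψ`, has a nonzero solution `φ` over
the algebraically closed field.

By the Nullstellensatz the system has only the zero solution if and only if, in some degree `d`,
every monomial is a combination of monomial multiples of the equations, that is, some maximal minor
of a Macaulay matrix does not vanish. Hence the vanishing of all these minors, which are homogeneous
polynomials over the base field in the coordinates of `Ψ`, is the required set of equations;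
finitely many suffice by noetherianity.
-/

section Elimination

open MvPolynomial

theorem exists_det_ne_zero_of_span_eq_top {K ι κ : Type*} [Field K] [Fintype κ] [DecidableEq κ]
    {v : ι → κ → K} (hv : Submodule.span K (Set.range v) = ⊤) :
    ∃ c : κ → ι, (Matrix.of (v ∘ c)).det ≠ 0 := by
  obtain ⟨β, a, -, hspan, hli⟩ := exists_linearIndependent' K v
  rw [hv] at hspan
  let e := (Pi.basisFun K κ).indexEquiv (Module.Basis.mk hli hspan.ge)
  have hrows : LinearIndependent K (Matrix.of (v ∘ a ∘ e)).row := hli.comp e e.injective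
  exact ⟨a ∘ e,
    ((Matrix.isUnit_iff_isUnit_det _).1 (Matrix.linearIndependent_rows_iff_isUnit.1 hrows)).ne_zero⟩

theorem exists_finset_subset_forall_eval_eq_zero_iff {σ R : Type*} [Finite σ] [CommRing R]
    [IsNoetherianRing R] (T : Set (MvPolynomial σ R)) :
    ∃ S : Finset (MvPolynomial σ R), ↑S ⊆ T ∧
      ∀ a : σ → R, (∀ G ∈ S, eval a G = 0) ↔ ∀ G ∈ T, eval a G = 0 := by
  obtain ⟨S, hST, hspan⟩ := (Submodule.fg_span_iff_fg_span_finset_subset T).1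
    (IsNoetherian.noetherian (Ideal.span T))
  refine ⟨S, hST, fun a => ?_⟩
  have hker (U : Set (MvPolynomial σ R)) :
      (∀ G ∈ U, eval a G = 0) ↔ Submodule.span (MvPolynomial σ R) U ≤ RingHom.ker (eval a) :=
    (Submodule.span_le (p := RingHom.ker (eval a))).symm
  rw [hker T, hspan, ← hker]
  rfl

/-- The exponent vectors of total degree `d` in the variables `τ`. -/
noncomputable def exponentsOfDegree (τ : Type*) [Finite τ] (d : ℕ) : Finset (τ →₀ ℕ) :=
  (Finsupp.finite_of_degree_eq d).toFinset

theorem mem_exponentsOfDegree {τ : Type*} [Finite τ] {d : ℕ} {b : τ →₀ ℕ} :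
    b ∈ exponentsOfDegree τ d ↔ b.degree = d := by
  simp [exponentsOfDegree]

theorem aeval_homogeneousComponent {τ R A : Type*} [Finite τ] [CommSemiring R] [CommSemiring A]
    [Algebra R A] (d : ℕ) (p : MvPolynomial τ R) (y : τ → A) :
    aeval y (homogeneousComponent d p) =
      ∑ b ∈ exponentsOfDegree τ d, algebraMap R A (coeff b p) * b.prod fun t e => y t ^ e := by
  classical
  simp only [homogeneousComponent_apply, map_sum, aeval_monomial]
  refine Finset.sum_subset (fun b hb => ?_) fun b hb hb' => ?_
  · exact mem_exponentsOfDegree.2 (Finset.mem_filter.1 hb).2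
  · have : coeff b p = 0 := by
      simpa [mem_exponentsOfDegree.1 hb] using hb'
    rw [this, map_zero, zero_mul]

/-- The square submatrix, with rows selected by `c`, of the Macaulay matrix of the polynomials `f i`
in degree `d`. The row of `(a, i)` consists of the degree `d` coefficients of the multiple of `f i`
by the monomial with exponents `a`; the degree of the product is not required to be `d`. -/
noncomputable def macaulayMatrix {ι τ R : Type*} [Finite τ] [CommSemiring R]
    (f : ι → MvPolynomial τ R) {d : ℕ} (c : exponentsOfDegree τ d → (τ →₀ ℕ) × ι) :
    Matrix (exponentsOfDegree τ d) (exponentsOfDegree τ d) R :=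
  Matrix.of fun b b' => coeff b' (monomial (c b).1 1 * f (c b).2)

section Matrices

variable {ι τ R : Type*} [Finite τ] [CommRing R] {D : ι → ℕ} {d : ℕ}

theorem macaulayMatrix_map {S : Type*} [CommRing S] (g : R →+* S) (f : ι → MvPolynomial τ R)
    (c : exponentsOfDegree τ d → (τ →₀ ℕ) × ι) :
    macaulayMatrix (fun i => map g (f i)) c = (macaulayMatrix f c).map g := by
  ext b b'
  simp only [macaulayMatrix, Matrix.of_apply, Matrix.map_apply, ← coeff_map, map_mul, map_monomial,
    map_one]

theorem map_macaulayMatrix_mulVec_eq_zero {A : Type*} [CommRing A] [Algebra R A]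
    {f : ι → MvPolynomial τ R} (hf : ∀ i, (f i).IsHomogeneous (D i)) {y : τ → A}
    (hfy : ∀ i, aeval y (f i) = 0) (c : exponentsOfDegree τ d → (τ →₀ ℕ) × ι) :
    ((macaulayMatrix f c).map (algebraMap R A)).mulVec
      (fun b => b.1.prod fun t e => y t ^ e) = 0 := by
  funext b
  have hom : (monomial (c b).1 (1 : R) * f (c b).2).IsHomogeneous _ :=
    (isHomogeneous_monomial 1 rfl).mul (hf (c b).2)
  have hzero : aeval y (homogeneousComponent d (monomial (c b).1 1 * f (c b).2)) = 0 := by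
    rw [homogeneousComponent_of_mem hom]
    split_ifs
    · rw [map_mul, hfy, mul_zero]
    · exact map_zero _
  rw [aeval_homogeneousComponent, ← Finset.sum_coe_sort] at hzero
  exact hzero

theorem det_macaulayMatrix_eq_zero [DecidableEq τ] {A : Type*} [CommRing A] [IsDomain A]
    [Algebra R A] [FaithfulSMul R A] {f : ι → MvPolynomial τ R}
    (hf : ∀ i, (f i).IsHomogeneous (D i)) {y : τ → A} (hy : y ≠ 0)
    (hfy : ∀ i, aeval y (f i) = 0) (c : exponentsOfDegree τ d → (τ →₀ ℕ) × ι) :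
    (macaulayMatrix f c).det = 0 := by
  obtain ⟨t, ht⟩ := Function.ne_iff.1 hy
  have hpow : (fun b : exponentsOfDegree τ d => b.1.prod fun t e => y t ^ e) ≠ 0 := by
    refine Function.ne_iff.2 ⟨⟨.single t d, mem_exponentsOfDegree.2 (by simp)⟩, ?_⟩
    simpa using fun h => absurd h ht
  apply FaithfulSMul.algebraMap_injective R A
  rw [map_zero, RingHom.map_det, RingHom.mapMatrix_apply, ← Matrix.exists_mulVec_eq_zero_iff]
  exact ⟨_, hpow, map_macaulayMatrix_mulVec_eq_zero hf hfy c⟩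

theorem isHomogeneous_det_macaulayMatrix [DecidableEq τ] {σ : Type*}
    {F : ι → MvPolynomial τ (MvPolynomial σ R)}
    {E : ι → ℕ} (hE : ∀ i b, (coeff b (F i)).IsHomogeneous (E i))
    (c : exponentsOfDegree τ d → (τ →₀ ℕ) × ι) :
    (macaulayMatrix F c).det.IsHomogeneous (∑ b, E (c b).2) := by
  have hentry (b b') : (macaulayMatrix F c b b').IsHomogeneous (E (c b).2) := by
    rw [macaulayMatrix, Matrix.of_apply, coeff_monomial_mul']
    split_ifs
    · simpa only [one_mul] using hE _ _
    · exact isHomogeneous_zero _ _ _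
  rw [← Matrix.det_transpose, Matrix.det_apply]
  refine IsHomogeneous.sum _ _ _ fun π _ => ?_
  rw [Units.smul_def, ← mem_homogeneousSubmodule]
  exact zsmul_mem (IsHomogeneous.prod _ _ _ fun b _ => hentry b _) _

end Matrices

theorem restrictScalars_span_range_eq_span_monomial_mul {ι τ R : Type*} [CommSemiring R]
    (f : ι → MvPolynomial τ R) :
    (Ideal.span (Set.range f)).restrictScalars R =
      Submodule.span R (Set.range fun q : (τ →₀ ℕ) × ι => monomial q.1 1 * f q.2) := by
  rw [Ideal.span, ← Submodule.span_smul_of_span_eq_top (basisMonomials τ R).span_eq,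
    coe_basisMonomials, Set.range_smul_range]
  rfl

section Field

variable {ι τ K : Type*} [Finite τ] [Field K] {f : ι → MvPolynomial τ K}

theorem span_coeff_monomial_mul_eq_top {d : ℕ}
    (hd : idealOfVars τ K ^ d ≤ Ideal.span (Set.range f)) :
    Submodule.span K (Set.range fun (q : (τ →₀ ℕ) × ι) (b : exponentsOfDegree τ d) =>
      coeff b (monomial q.1 1 * f q.2)) = ⊤ := by
  classical
  let coeffs : MvPolynomial τ K →ₗ[K] (exponentsOfDegree τ d → K) :=
    LinearMap.pi fun b => lcoeff K b.1
  have hspan := congrArg (Submodule.map coeffs) (restrictScalars_span_range_eq_span_monomial_mul f)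
  rw [Submodule.map_span, ← Set.range_comp] at hspan
  refine hspan.symm.trans (eq_top_iff.2 ?_)
  rw [← (Pi.basisFun K (exponentsOfDegree τ d)).span_eq, Submodule.span_le]
  rintro _ ⟨b, rfl⟩
  refine ⟨monomial b 1, hd ?_, ?_⟩
  · exact (monomial_mem_pow_idealOfVars_iff d _ one_ne_zero).2 (mem_exponentsOfDegree.1 b.2).ge
  · funext b'
    simp only [coeffs, LinearMap.pi_apply, lcoeff_apply, coeff_monomial, Pi.basisFun_apply,
      Pi.single_apply, Subtype.ext_iff, eq_comm (a := b.1)]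

theorem exists_det_macaulayMatrix_ne_zero [DecidableEq τ] {d : ℕ}
    (hd : idealOfVars τ K ^ d ≤ Ideal.span (Set.range f)) :
    ∃ c : exponentsOfDegree τ d → (τ →₀ ℕ) × ι, (macaulayMatrix f c).det ≠ 0 :=
  exists_det_ne_zero_of_span_eq_top (span_coeff_monomial_mul_eq_top hd)

theorem exists_pow_idealOfVars_le_span (L : Type*) [Field L] [Algebra K L] [IsAlgClosed L]
    (hf : ∀ y : τ → L, (∀ i, aeval y (f i) = 0) → y = 0) :
    ∃ d, idealOfVars τ K ^ d ≤ Ideal.span (Set.range f) := by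
  refine Ideal.exists_pow_le_of_le_radical_of_fg ?_ (idealOfVars_fg τ K)
  rw [← vanishingIdeal_zeroLocus_eq_radical (K := L), zeroLocus_span, idealOfVars, Ideal.span_le]
  rintro _ ⟨t, rfl⟩ y hy
  rw [hf y fun i => hy _ ⟨i, rfl⟩, aeval_X, Pi.zero_apply]

theorem exists_ne_zero_aeval_eq_zero_iff_det_macaulayMatrix [DecidableEq τ] {L : Type*} [Field L]
    [Algebra K L] [IsAlgClosed L] {D : ι → ℕ} (hf : ∀ i, (f i).IsHomogeneous (D i)) :
    (∃ y : τ → L, y ≠ 0 ∧ ∀ i, aeval y (f i) = 0) ↔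
      ∀ (d : ℕ) (c : exponentsOfDegree τ d → (τ →₀ ℕ) × ι), (macaulayMatrix f c).det = 0 := by
  refine ⟨fun ⟨y, hy, hfy⟩ d c => det_macaulayMatrix_eq_zero hf hy hfy c, fun hdet => ?_⟩
  by_contra! hno
  obtain ⟨d, hd⟩ := exists_pow_idealOfVars_le_span L fun y hfy =>
    by_contra fun hy => (hno y hy).elim fun i hi => hi (hfy i)
  obtain ⟨c, hc⟩ := exists_det_macaulayMatrix_ne_zero hd
  exact hc (hdet d c)

/-- The main theorem of elimination theory: the variables `τ` are coordinates of a projective space,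
the variables `σ` are coordinates of the affine space to which one projects. -/
theorem exists_finset_isHomogeneous_forall_eval_eq_zero_iff {σ : Type*} [Finite σ] (L : Type*)
    [Field L] [Algebra K L] [IsAlgClosed L] {F : ι → MvPolynomial τ (MvPolynomial σ K)}
    {D E : ι → ℕ} (hD : ∀ i, (F i).IsHomogeneous (D i))
    (hE : ∀ i b, (coeff b (F i)).IsHomogeneous (E i)) :
    ∃ S : Finset (MvPolynomial σ K), (∀ G ∈ S, ∃ d, G.IsHomogeneous d) ∧
      ∀ a : σ → K, (∃ y : τ → L, y ≠ 0 ∧ ∀ i, aeval y (map (eval a) (F i)) = 0) ↔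
        ∀ G ∈ S, eval a G = 0 := by
  classical
  obtain ⟨S, hST, hS⟩ := exists_finset_subset_forall_eval_eq_zero_iff
    {G : MvPolynomial σ K | ∃ (d : ℕ) (c : exponentsOfDegree τ d → (τ →₀ ℕ) × ι),
      (macaulayMatrix F c).det = G}
  refine ⟨S, fun G hG => ?_, fun a => ?_⟩
  · obtain ⟨d, c, rfl⟩ := hST hG
    exact ⟨_, isHomogeneous_det_macaulayMatrix hE c⟩
  · rw [hS, exists_ne_zero_aeval_eq_zero_iff_det_macaulayMatrix fun i => (hD i).map (eval a)]
    have hdet (d : ℕ) (c : exponentsOfDegree τ d → (τ →₀ ℕ) × ι) :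
        (macaulayMatrix (fun i => map (eval a) (F i)) c).det = eval a (macaulayMatrix F c).det := by
      rw [macaulayMatrix_map, RingHom.map_det, RingHom.mapMatrix_apply]
    simp only [hdet]
    exact ⟨by rintro h _ ⟨d, c, rfl⟩; exact h d c, fun h d c => h _ ⟨d, c, rfl⟩⟩

end Field

end Elimination

section Contraction

open Function (update)

theorem multilinearMap_eq_zero_of_forall_mem_span {R ι M N : Type*} [Semiring R] [Finite ι]
    [AddCommMonoid M] [AddCommMonoid N] [Module R M] [Module R N]
    (f : MultilinearMap R (fun _ : ι => M) N) {S : ι → Set M}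
    (hS : ∀ v : ι → M, (∀ p, v p ∈ S p) → f v = 0) {v : ι → M}
    (hv : ∀ p, v p ∈ Submodule.span R (S p)) : f v = 0 := by
  classical
  have := Fintype.ofFinite ι
  suffices h : ∀ (t : Finset ι) (v : ι → M), (∀ p ∈ t, v p ∈ Submodule.span R (S p)) →
      (∀ p ∉ t, v p ∈ S p) → f v = 0 from h Finset.univ v (by simpa using hv) (by simp)
  intro t
  induction t using Finset.induction_on with
  | empty => exact fun v _ hv => hS v (by simpa using hv)
  | insert q t hqt ih =>
    intro v hspan hmem
    suffices Submodule.span R (S q) ≤ LinearMap.ker (f.toLinearMap v q) by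
      simpa using this (hspan q (Finset.mem_insert_self q t))
    refine Submodule.span_le.2 fun x hx => ih _ (fun p hp => ?_) fun p hp => ?_
    · rw [Function.update_of_ne (ne_of_mem_of_not_mem hp hqt)]
      exact hspan p (Finset.mem_insert_of_mem hp)
    · rcases eq_or_ne p q with rfl | hpq
      · rwa [Function.update_self]
      · rw [Function.update_of_ne hpq]
        exact hmem p (by simp [hpq, hp])

theorem multilinearMap_pi_apply_eq_sum {R ι κ N : Type*} [CommSemiring R] [Fintype ι]
    [Fintype κ] [DecidableEq ι] [AddCommMonoid N] [Module R N]
    (f : MultilinearMap R (fun _ : ι => κ → R) N) (v : ι → κ → R) :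
    f v = ∑ i : ι → κ, (∏ p, v p (i p)) • f (fun p => Pi.basisFun R κ (i p)) := by
  classical
  conv_lhs => rw [funext fun p => ((Pi.basisFun R κ).sum_repr (v p)).symm, f.map_sum]
  simp only [f.map_smul_univ, Pi.basisFun_repr]

theorem detRowAlternating_compLinearMap_ne_zero {ι κ K : Type*} [Fintype ι]
    [Fintype κ] [DecidableEq κ] [Field K] {A : Matrix κ ι K} (hA : LinearIndependent K A.row) :
    (Matrix.detRowAlternating (R := K) (n := κ)).compLinearMap A.mulVecLin ≠ 0 := by
  have hsurj : Function.Surjective A.mulVecLin := by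
    rw [← LinearMap.range_eq_top]
    refine Submodule.eq_top_of_finrank_eq ?_
    rw [Module.finrank_fintype_fun_eq_card]
    exact hA.rank_matrix
  choose v hv using fun a => hsurj (Pi.single a 1)
  intro h
  have hdet : (Matrix.of fun a => A.mulVecLin (v a)).det = 0 := DFunLike.congr_fun h v
  simp only [hv] at hdet
  have hone : (Matrix.of fun a => Pi.single a (1 : K)) = (1 : Matrix κ κ K) := by
    ext a b
    simp [Matrix.one_apply, Pi.single_apply, eq_comm]
  simp [hone] at hdet

variable {ι κ K : Type*} [DecidableEq ι] [DecidableEq κ]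

/-- The contraction of an alternating form `f` on `K ^ ι` with the standard basis vectors `e_{J p}`
in all slots `p ≠ q`. It is a linear form on `K ^ ι`, and it is encoded by its vector of values
on the standard basis. The entry of `J` at `q` plays no role. -/
def alternatingContraction [Semiring K] (f : (ι → K) [⋀^κ]→ₗ[K] K) (x : (κ → ι) × κ) : ι → K :=
  fun i => f fun p => Pi.single (update x.1 x.2 i p) 1

theorem alternatingContraction_apply_of_ne [Semiring K] (f : (ι → K) [⋀^κ]→ₗ[K] K) (J : κ → ι)
    {p q : κ} (hpq : p ≠ q) : alternatingContraction f (J, q) (J p) = 0 :=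
  f.map_eq_zero_of_eq _ (by simp [hpq]) hpq

theorem linearIndependent_alternatingContraction [Finite κ] [CommRing K] [IsDomain K]
    {f : (ι → K) [⋀^κ]→ₗ[K] K} {J : κ → ι} (hJ : (f fun p => Pi.single (J p) 1) ≠ 0) :
    LinearIndependent K fun q => alternatingContraction f (J, q) := by
  have := Fintype.ofFinite κ
  rw [Fintype.linearIndependent_iff]
  intro g hg p
  have hsum := congrFun hg (J p)
  rw [Finset.sum_apply, Finset.sum_eq_single p] at hsum
  · simpa [alternatingContraction, hJ] using hsum
  · intro q _ hqp
    rw [Pi.smul_apply, alternatingContraction_apply_of_ne f J hqp.symm, smul_zero]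
  · simp

theorem card_le_finrank_span_alternatingContraction [Finite ι] [Fintype κ] [Field K]
    {f : (ι → K) [⋀^κ]→ₗ[K] K} (hf : f ≠ 0) :
    Fintype.card κ ≤
      Module.finrank K (Submodule.span K (Set.range (alternatingContraction f))) := by
  obtain ⟨J, hJ⟩ : ∃ J : κ → ι, (f fun p => Pi.single (J p) 1) ≠ 0 := by
    by_contra! h
    exact hf ((Pi.basisFun K ι).ext_alternating fun J _ => by simpa using h J)
  rw [← finrank_span_eq_card (linearIndependent_alternatingContraction hJ)]
  refine Submodule.finrank_mono (Submodule.span_mono ?_)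
  exact Set.range_comp_subset_range (fun q => (J, q)) (alternatingContraction f)

/-- Every contraction of the pullback factors through `A`, and a linear form `ℓ ∘ A` is a
combination of the rows of `A`. -/
theorem alternatingContraction_compLinearMap_mem_span [Fintype ι] [CommRing K] {α : Type*}
    [Finite α] (g : (α → K) [⋀^κ]→ₗ[K] K) (A : Matrix α ι K) (x : (κ → ι) × κ) :
    alternatingContraction (g.compLinearMap A.mulVecLin) x ∈
      Submodule.span K (Set.range A.row) := by
  classical
  have := Fintype.ofFinite α
  obtain ⟨J, q⟩ := x
  let ℓ : (α → K) →ₗ[K] K := g.toMultilinearMap.toLinearMap (fun p => A.col (J p)) q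
  have hcontr : alternatingContraction (g.compLinearMap A.mulVecLin) (J, q) =
      ∑ a, ℓ (Pi.single a 1) • A.row a := by
    funext i
    have hval : alternatingContraction (g.compLinearMap A.mulVecLin) (J, q) i = ℓ (A.col i) := by
      simp only [alternatingContraction, AlternatingMap.compLinearMap_apply]
      refine congrArg g (funext fun p => ?_)
      rcases eq_or_ne p q with rfl | hpq <;> simp [*]
    rw [hval, pi_eq_sum_univ' (A.col i), map_sum]
    simp [mul_comm]
  rw [hcontr]
  exact Submodule.sum_mem _ fun a _ => Submodule.smul_mem _ _ (Submodule.subset_span ⟨a, rfl⟩)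

end Contraction

namespace SkewForm

open MvPolynomial
open Function (Surjective update)

section Nullity

variable {K : Type*} [Field K] {s k r n m : ℕ}

/-- The `j`-th coordinate of the values of a form, as an alternating map. -/
noncomputable def component (Ψ : SkewForm K s n m) (j : Fin m) : (Fin n → K) [⋀^Fin s]→ₗ[K] K :=
  (LinearMap.proj j ∘ₗ Ψ).compAlternatingMap (exteriorPower.ιMulti K s)

theorem component_apply (Ψ : SkewForm K s n m) (j : Fin m) (v : Fin s → Fin n → K) :
    component Ψ j v = Ψ (exteriorPower.ιMulti K s v) j := rfl

theorem component_zero_eq_zero_iff {φ : SkewForm K s n 1} : component φ 0 = 0 ↔ φ = 0 := by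
  refine ⟨fun h => exteriorPower.linearMap_ext ?_, fun h => by rw [h]; rfl⟩
  ext v j
  rw [Subsingleton.elim j 0]
  exact DFunLike.congr_fun h v

theorem component_zero_surjective :
    Surjective fun φ : SkewForm K s n 1 => component φ 0 := fun f =>
  ⟨LinearMap.pi fun _ => exteriorPower.alternatingMapLinearEquiv f,
    exteriorPower.alternatingMapLinearEquiv_comp_ιMulti f⟩

theorem VanishesOn.mono {Ψ : SkewForm K s n m} {W W' : Submodule K (Fin n → K)}
    (h : VanishesOn k Ψ W') (hW : W ≤ W') : VanishesOn k Ψ W :=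
  fun v hv => h v fun i hi => hW (hv i hi)

theorem vanishesOn_span_range_iff {κ : Type*} {Ψ : SkewForm K s n m} {w : κ → Fin n → K} :
    VanishesOn k Ψ (Submodule.span K (Set.range w)) ↔
      ∀ c : Fin s → κ ⊕ Fin n, (∀ p : Fin s, (p : ℕ) < k → (c p).isLeft) →
        ∀ j, component Ψ j (fun p => Sum.elim w (Pi.basisFun K (Fin n)) (c p)) = 0 := by
  constructor
  · intro h c hc j
    rw [component_apply, h _ fun p hp => ?_, Pi.zero_apply]
    obtain ⟨a, ha⟩ := Sum.isLeft_iff.1 (hc p hp)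
    rw [ha, Sum.elim_inl]
    exact Submodule.subset_span ⟨a, rfl⟩
  · intro h v hv
    funext j
    refine multilinearMap_eq_zero_of_forall_mem_span (component Ψ j).toMultilinearMap
      (S := fun p => {x | ∃ a : κ ⊕ Fin n, ((p : ℕ) < k → a.isLeft) ∧
        Sum.elim w (Pi.basisFun K (Fin n)) a = x}) (fun z hz => ?_) fun p => ?_
    · choose c hc hcz using hz
      rw [← funext hcz]
      exact h c hc j
    · by_cases hp : (p : ℕ) < k
      · refine Submodule.span_mono ?_ (hv p hp)
        rintro _ ⟨a, rfl⟩
        exact ⟨.inl a, by simp⟩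
      · refine Submodule.span_mono ?_ ((Pi.basisFun K (Fin n)).mem_span (v p))
        rintro _ ⟨u, rfl⟩
        exact ⟨.inr u, by simp [hp]⟩

theorem le_nullity_iff (hr : r ≠ 0) {Ψ : SkewForm K s n m} :
    r ≤ nullity k Ψ ↔ ∃ W, VanishesOn k Ψ W ∧ r ≤ Module.finrank K W := by
  let dims : Set ℕ := {d | ∃ W, VanishesOn k Ψ W ∧ Module.finrank K W = d}
  change r ≤ sSup dims ↔ _
  have hbdd : BddAbove dims := by
    refine ⟨n, ?_⟩
    rintro _ ⟨W, -, rfl⟩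
    simpa using W.finrank_le
  constructor
  · intro h
    have hne : dims.Nonempty := by
      refine Set.nonempty_iff_ne_empty.2 fun hempty => hr ?_
      rwa [hempty, csSup_empty, bot_eq_zero, Nat.le_zero] at h
    obtain ⟨W, hW, hd⟩ := Nat.sSup_mem hne hbdd
    exact ⟨W, hW, h.trans hd.ge⟩
  · rintro ⟨W, hW, hrW⟩
    exact hrW.trans (le_csSup hbdd ⟨W, hW, rfl⟩)

theorem le_nullity_iff_exists_vanishesOn_contraction (hr : r ≠ 0) {Ψ : SkewForm K s n m} :
    r ≤ nullity k Ψ ↔ ∃ φ : SkewForm K r n 1, φ ≠ 0 ∧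
      VanishesOn k Ψ (Submodule.span K (Set.range (alternatingContraction (component φ 0)))) := by
  rw [le_nullity_iff hr]
  constructor
  · rintro ⟨W, hW, hrW⟩
    obtain ⟨w, hw⟩ := exists_linearIndependent_of_le_finrank hrW
    let A : Matrix (Fin r) (Fin n) K := Matrix.of fun a => w a
    have hA : LinearIndependent K A.row := hw.map' W.subtype W.ker_subtype
    obtain ⟨φ, hφ⟩ := component_zero_surjective (Matrix.detRowAlternating.compLinearMap A.mulVecLin)
    refine ⟨φ, fun h => ?_, hW.mono (Submodule.span_le.2 ?_)⟩
    · rw [← component_zero_eq_zero_iff] at h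
      exact detRowAlternating_compLinearMap_ne_zero hA (hφ.symm.trans h)
    · rintro _ ⟨x, rfl⟩
      have hrows : Submodule.span K (Set.range A.row) ≤ W :=
        Submodule.span_le.2 (Set.range_subset_iff.2 fun a => (w a).2)
      simp only [hφ]
      exact hrows (alternatingContraction_compLinearMap_mem_span _ A x)
  · rintro ⟨φ, hφ, hvan⟩
    refine ⟨_, hvan, ?_⟩
    simpa using card_le_finrank_span_alternatingContraction
      (mt component_zero_eq_zero_iff.1 hφ)

end Nullity

section Coordinates

variable {K : Type*} [Field K] {s n m : ℕ}

theorem coords_surjective : Surjective (coords (K := K) (s := s) (n := n) (m := m)) := fun y =>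
  ⟨(wedgeBasis K s n).constr K fun I j => y (I, j), by
    funext p
    simp only [coords, Module.Basis.constr_basis]⟩

theorem coords_eq_zero_iff {Ψ : SkewForm K s n m} : coords Ψ = 0 ↔ Ψ = 0 := by
  refine ⟨fun h => (wedgeBasis K s n).ext fun I => ?_, fun h => by rw [h]; rfl⟩
  funext j
  exact congrFun h (I, j)

variable (L : Type*) [Field L] [Algebra K L]

theorem coords_extendScalars (Ψ : SkewForm K s n m) :
    coords (extendScalars L Ψ) = algebraMap K L ∘ coords Ψ := by
  funext p
  simp only [coords, extendScalars, Module.Basis.constr_basis, Function.comp_apply]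

theorem extendScalars_self (Ψ : SkewForm K s n m) : extendScalars K Ψ = Ψ :=
  (wedgeBasis K s n).ext fun I => (wedgeBasis K s n).constr_basis K _ I

theorem wedgeBasis_repr_iMulti_basisFun (i : Fin s → Fin n) (I : Set.powersetCard (Fin n) s) :
    (wedgeBasis L s n).repr (exteriorPower.ιMulti L s (Pi.basisFun L (Fin n) ∘ i)) I =
      algebraMap K L
        ((wedgeBasis K s n).repr (exteriorPower.ιMulti K s (Pi.basisFun K (Fin n) ∘ i)) I) := by
  simp only [wedgeBasis, exteriorPower.basis_repr_apply, exteriorPower.ιMultiDual_apply_ιMulti,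
    RingHom.map_det]
  congr 1
  ext a b
  simp [Pi.single_apply, apply_ite (algebraMap K L)]

/-- The linear polynomial in the coordinates of a form which gives the `j`-th entry of its value at
`e_{i_1} ∧ … ∧ e_{i_s}` for an arbitrary, not necessarily increasing, sequence of indices. -/
noncomputable def basisValue (K : Type*) [Field K] {s n m : ℕ} (i : Fin s → Fin n) (j : Fin m) :
    MvPolynomial (Set.powersetCard (Fin n) s × Fin m) K :=
  ∑ I, C ((wedgeBasis K s n).repr (exteriorPower.ιMulti K s (Pi.basisFun K (Fin n) ∘ i)) I) *
    X (I, j)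

theorem isHomogeneous_basisValue (i : Fin s → Fin n) (j : Fin m) :
    (basisValue K i j).IsHomogeneous 1 :=
  IsHomogeneous.sum _ _ _ fun _ _ => isHomogeneous_C_mul_X _ _

variable {L}

theorem aeval_coords_basisValue (Ψ : SkewForm L s n m) (i : Fin s → Fin n) (j : Fin m) :
    aeval (coords Ψ) (basisValue K i j) = component Ψ j (Pi.basisFun L (Fin n) ∘ i) := by
  rw [component_apply, ← (wedgeBasis L s n).sum_repr (exteriorPower.ιMulti L s _)]
  simp only [basisValue, coords, map_sum, map_mul, aeval_C, aeval_X, map_smul, Finset.sum_apply,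
    Pi.smul_apply, smul_eq_mul, wedgeBasis_repr_iMulti_basisFun (K := K) L]

theorem algebraMap_eval_basisValue (Ψ : SkewForm K s n m) (i : Fin s → Fin n) (j : Fin m) :
    algebraMap K L (eval (coords Ψ) (basisValue K i j)) =
      component (extendScalars L Ψ) j fun p => Pi.basisFun L (Fin n) (i p) := by
  rw [← coe_aeval_eq_eval, RingHom.coe_coe, ← aeval_algebraMap_apply, ← coords_extendScalars,
    aeval_coords_basisValue]
  rfl

end Coordinates

section Equations

variable {K L : Type*} [Field K] [Field L] [Algebra K L] {s k r n m : ℕ}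

/-- The vectors to be substituted in the slots of a form, namely the contractions of an `r`-form `φ`
and the standard basis vectors, with entries written as polynomials in the coordinates of `φ`. -/
noncomputable def testVector (K : Type*) [Field K] {r n : ℕ} :
    ((Fin r → Fin n) × Fin r) ⊕ Fin n → Fin n →
      MvPolynomial (Set.powersetCard (Fin n) r × Fin 1) K
  | .inl (J, q), i => basisValue K (update J q i) 0
  | .inr u, i => C (Pi.basisFun K (Fin n) u i)

theorem aeval_coords_testVector (φ : SkewForm L r n 1) (x : ((Fin r → Fin n) × Fin r) ⊕ Fin n)
    (i : Fin n) :
    aeval (coords φ) (testVector K x i) =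
      Sum.elim (alternatingContraction (component φ 0)) (Pi.basisFun L (Fin n)) x i := by
  rcases x with ⟨J, q⟩ | u
  · rw [testVector, aeval_coords_basisValue, Sum.elim_inl, alternatingContraction]
    refine congrArg _ (funext fun p => ?_)
    simp
  · simp [testVector, Pi.single_apply]

theorem exists_isHomogeneous_testVector (x : ((Fin r → Fin n) × Fin r) ⊕ Fin n) :
    ∃ d, ∀ i, (testVector K x i).IsHomogeneous d := by
  rcases x with ⟨J, q⟩ | u
  · exact ⟨1, fun i => isHomogeneous_basisValue _ _⟩
  · exact ⟨0, fun i => isHomogeneous_C _ _⟩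

/-- The `j`-th entry of the value of a form `Ψ` at the test vectors `c 0, …, c (s - 1)`, as a
polynomial in the coordinates of the form `φ` to be contracted, whose coefficients are polynomials
in the coordinates of `Ψ`. -/
noncomputable def testValue (K : Type*) [Field K] {s r n m : ℕ}
    (c : Fin s → ((Fin r → Fin n) × Fin r) ⊕ Fin n) (j : Fin m) :
    MvPolynomial (Set.powersetCard (Fin n) r × Fin 1)
      (MvPolynomial (Set.powersetCard (Fin n) s × Fin m) K) :=
  ∑ i : Fin s → Fin n, C (basisValue K i j) * map C (∏ p, testVector K (c p) (i p))

theorem exists_isHomogeneous_testValue (c : Fin s → ((Fin r → Fin n) × Fin r) ⊕ Fin n)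
    (j : Fin m) : ∃ d, (testValue K c j).IsHomogeneous d := by
  choose d hd using fun p => exists_isHomogeneous_testVector (K := K) (c p)
  exact ⟨∑ p, d p, IsHomogeneous.sum _ _ _ fun i _ =>
    ((IsHomogeneous.prod _ _ _ fun p _ => hd p (i p)).map C).C_mul _⟩

theorem isHomogeneous_coeff_testValue (c : Fin s → ((Fin r → Fin n) × Fin r) ⊕ Fin n) (j : Fin m)
    (b : Set.powersetCard (Fin n) r × Fin 1 →₀ ℕ) :
    (coeff b (testValue K c j)).IsHomogeneous 1 := by
  simp only [testValue, coeff_sum, coeff_C_mul, coeff_map]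
  refine IsHomogeneous.sum _ _ _ fun i _ => ?_
  rw [mul_comm]
  exact (isHomogeneous_basisValue i j).C_mul _

theorem aeval_coords_testValue (Ψ : SkewForm K s n m) (φ : SkewForm L r n 1)
    (c : Fin s → ((Fin r → Fin n) × Fin r) ⊕ Fin n) (j : Fin m) :
    aeval (coords φ) (map (eval (coords Ψ)) (testValue K c j)) =
      component (extendScalars L Ψ) j fun p =>
        Sum.elim (alternatingContraction (component φ 0)) (Pi.basisFun L (Fin n)) (c p) := by
  have hcoeff : (eval (coords Ψ)).comp C = RingHom.id K := RingHom.ext fun a => eval_C a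
  rw [← AlternatingMap.coe_multilinearMap, multilinearMap_pi_apply_eq_sum]
  simp only [testValue, map_sum, map_mul, map_C, aeval_C, map_map, hcoeff, map_id, map_prod,
    aeval_coords_testVector, algebraMap_eval_basisValue, AlternatingMap.coe_multilinearMap,
    smul_eq_mul, mul_comm]

/-- The indices of the equations saying that a form vanishes on the span of the contractions: a test
vector for each slot, which in the first `k` slots is a contraction, and an entry of the value. -/
abbrev TestIndex (s k r n m : ℕ) : Type :=
  {c : Fin s → ((Fin r → Fin n) × Fin r) ⊕ Fin n // ∀ p : Fin s, (p : ℕ) < k → (c p).isLeft} ×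
    Fin m

theorem forall_aeval_testValue_eq_zero_iff {Ψ : SkewForm K s n m} {φ : SkewForm L r n 1} :
    (∀ x : TestIndex s k r n m,
      aeval (coords φ) (map (eval (coords Ψ)) (testValue K x.1.1 x.2)) = 0) ↔
    VanishesOn k (extendScalars L Ψ)
      (Submodule.span L (Set.range (alternatingContraction (component φ 0)))) := by
  simp only [aeval_coords_testValue, vanishesOn_span_range_iff, Prod.forall, Subtype.forall]

end Equations

end SkewForm

theorem mainTheorem4_general (s k r n m : ℕ) (K L : Type*) [Field K] [Field L] [Algebra K L]
    [IsAlgClosed L] :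
    SkewForm.IsHomogeneousAlgebraicSet
      {Ψ : SkewForm K s n m | r ≤ SkewForm.nullity k (SkewForm.extendScalars L Ψ)} := by
  rcases eq_or_ne r 0 with rfl | hr
  · exact ⟨∅, by simp, by simp⟩
  obtain ⟨S, hS, hSF⟩ := exists_finset_isHomogeneous_forall_eval_eq_zero_iff L
    (F := fun x : SkewForm.TestIndex s k r n m => SkewForm.testValue K x.1.1 x.2)
    (fun x => (SkewForm.exists_isHomogeneous_testValue x.1.1 x.2).choose_spec)
    (fun x => SkewForm.isHomogeneous_coeff_testValue x.1.1 x.2)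
  refine ⟨S, hS, fun Ψ => ?_⟩
  rw [← hSF, Set.mem_ofPred_eq, SkewForm.le_nullity_iff_exists_vanishesOn_contraction hr,
    SkewForm.coords_surjective.exists]
  simp only [SkewForm.forall_aeval_testValue_eq_zero_iff, ne_eq, SkewForm.coords_eq_zero_iff]

theorem mainTheorem4 (s k r n m : ℕ) (hks : k ≤ s) :
    (∀ (K : Type*) [Field K] [IsAlgClosed K],
      SkewForm.IsHomogeneousAlgebraicSet
        {Ψ : SkewForm K s n m | r ≤ SkewForm.nullity k Ψ}) ∧
    (∀ (K : Type*) [Field K] (L : Type*) [Field L] [Algebra K L] [IsAlgClosure K L],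
      SkewForm.IsHomogeneousAlgebraicSet
        {Ψ : SkewForm K s n m | r ≤ SkewForm.nullity k (SkewForm.extendScalars L Ψ)}) := by
  refine ⟨fun K _ _ => ?_, fun K _ L _ _ _ => ?_⟩
  · simpa only [SkewForm.extendScalars_self] using mainTheorem4_general s k r n m K K
  · have := IsAlgClosure.isAlgClosed K (K := L)
    exact mainTheorem4_general s k r n m K L
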